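/- Let $K$ be a field of characteristic $0$ and $L$ an algebraically closed extension field of $K$ (for instance $K\subseteq\mathbb{C}$ and $L=\overline{K}$). Let $\chi(x,y)\in K[x,y]$ be monic of degree $n\ge 1$ in $y$ and have nonzero constant term $\chi(0,0)\neq 0$, and write $\chi'=\partial\chi/\partial y$. Let $P\subset\mathbb{R}^2$ be the Newton polygon of $\chi$, i.e. the convex hull of the exponent vectors $(i,j)$ of the nonzero terms $c_{ij}x^iy^j$ of $\chi$. For a nonzero Puiseux series $R$ in $1/x$ with coefficients in $L$ (an element of $\bigcup_{N\ge1}L((x^{-1/N}))$), write $R=c\,x^{h}+(\text{smaller powers of }x)$ with $c\ne0$, and put $h(R)=h$; the term $c\,x^{h}$ is called the highest term of $R$. Let $y^{(1)},\dots,y^{(n)}$ be the solutions of $\chi(x,y)=0$ in this field of Puiseux series, and assume that their highest terms are pairwise distinct. Then for every $(a,m)\in\mathbb{Z}^2_{\ge0}$: 1. the inequalities $$h\!\left(\frac{x^a\,(y^{(\ell)})^m}{\chi'(y^{(\ell)})}\right)<-1,\qquad \ell=1,\dots,n,$$ hold if and only if $(a+1,m+1)$ is an interior lattice point of $P$; 2.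 if the solutions are numbered so that $h_1\ge h_2\ge\cdots\ge h_n$, where $h_\ell=h(y^{(\ell)})$, then the inequalities $$a<h_1+\cdots+h_{\ell-1}+(n-\ell-m)\,h_\ell-1,\qquad \ell=1,\dots,n,$$ hold if and only if $(a+1,m+1)$ is an interior lattice point of $P$ (so they are equivalent to those in 1). -/

import Mathlib

open Polynomial
open scoped Polynomial.Bivariate

/-! Puiseux series in `t = 1/x` are realised inside the field of Hahn series `HahnSeries ℚ L`
in `t`: the coefficient at `q : ℚ` belongs to `t ^ q = x ^ (-q)`. -/

/-- The exponents of `z` have the bounded denominator `N`. -/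
def HasDenominator {L : Type*} [Field L] (z : HahnSeries ℚ L) (N : ℕ) : Prop :=
  0 < N ∧ ∀ q ∈ z.support, ∃ k : ℤ, q * N = k

theorem HasDenominator.mul_right {L : Type*} [Field L] {z : HahnSeries ℚ L} {N : ℕ}
    (h : HasDenominator z N) {M : ℕ} (hM : 0 < M) : HasDenominator z (N * M) := by
  refine ⟨Nat.mul_pos h.1 hM, fun q hq => ?_⟩
  obtain ⟨k, hk⟩ := h.2 q hq
  exact ⟨k * M, by push_cast; rw [← hk]; ring⟩

theorem HasDenominator.add {L : Type*} [Field L] {y z : HahnSeries ℚ L} {N : ℕ}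
    (hy : HasDenominator y N) (hz : HasDenominator z N) : HasDenominator (y + z) N := by
  refine ⟨hy.1, fun q hq => ?_⟩
  rcases HahnSeries.support_add_subset y z hq with h | h
  exacts [hy.2 q h, hz.2 q h]

theorem HasDenominator.mul {L : Type*} [Field L] {y z : HahnSeries ℚ L} {N : ℕ}
    (hy : HasDenominator y N) (hz : HasDenominator z N) : HasDenominator (y * z) N := by
  refine ⟨hy.1, fun q hq => ?_⟩
  obtain ⟨u, hu, v, hv, rfl⟩ := Set.mem_add.1 (HahnSeries.support_mul_subset hq)
  obtain ⟨k, hk⟩ := hy.2 u hu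
  obtain ⟨l, hl⟩ := hz.2 v hv
  exact ⟨k + l, by push_cast; rw [← hk, ← hl]; ring⟩

theorem hasDenominator_single {L : Type*} [Field L] (k : ℤ) (c : L) :
    HasDenominator (HahnSeries.single (k : ℚ) c) 1 := by
  refine ⟨one_pos, fun q hq => ⟨k, ?_⟩⟩
  have := HahnSeries.support_single_subset hq
  simp_all

theorem HasDenominator.inv {L : Type*} [Field L] {z : HahnSeries ℚ L} {N : ℕ}
    (h : HasDenominator z N) : HasDenominator z⁻¹ N := by
  have hN : (0 : ℚ) < N := by exact_mod_cast h.1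
  let f : ℤ →+ ℚ :=
    { toFun := fun k => k / N
      map_zero' := by simp
      map_add' := fun a b => by push_cast; ring }
  have hle : ∀ g g' : ℤ, f g ≤ f g' ↔ g ≤ g' := fun g g' => by
    change (g : ℚ) / N ≤ g' / N ↔ _
    rw [div_le_div_iff_of_pos_right hN]
    exact Int.cast_le
  have hinj : Function.Injective f := fun a b hab =>
    le_antisymm ((hle a b).1 hab.le) ((hle b a).1 hab.ge)
  let φ : HahnSeries ℤ L →+* HahnSeries ℚ L := HahnSeries.embDomainRingHom f hinj hle
  let e : ℤ ↪o ℚ := ⟨⟨f, hinj⟩, hle _ _⟩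
  have hφ : ∀ w, φ w = HahnSeries.embDomain e w := fun w => rfl
  let w : HahnSeries ℤ L :=
    { coeff := fun k => z.coeff (f k)
      isPWO_support' := by
        rw [Set.isPWO_iff_isWF, Set.isWF_iff_no_descending_seq]
        intro s hs hmem
        have hz := Set.isWF_iff_no_descending_seq.1 z.isWF_support
        exact hz (fun n => f (s n))
          (fun a b hab => lt_of_le_not_ge ((hle _ _).2 (hs hab).le)
            (fun hc => absurd ((hle _ _).1 hc) (not_le.2 (hs hab)))) hmem }
  have hzw : φ w = z := by
    ext q
    rw [hφ]
    by_cases hq : ∃ k : ℤ, q = f k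
    · obtain ⟨k, rfl⟩ := hq
      exact HahnSeries.embDomain_coeff (f := e) (x := w) (a := k)
    · rw [HahnSeries.embDomain_of_notMem_range]
      · by_contra hne
        obtain ⟨k, hk⟩ := h.2 q (Ne.symm hne)
        exact hq ⟨k, by change q = (k : ℚ) / N; rw [← hk]; field_simp⟩
      · rintro ⟨k, hk⟩
        exact hq ⟨k, hk.symm⟩
  refine ⟨h.1, fun q hq => ?_⟩
  rw [← hzw, ← map_inv₀, hφ] at hq
  obtain ⟨k, -, rfl⟩ := HahnSeries.support_embDomain_subset hq
  exact ⟨k, by change (k : ℚ) / N * N = k; field_simp⟩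

/-- The field `⋃_N L((x^{-1/N}))` of Puiseux series in `1/x` with coefficients in `L`. -/
noncomputable def PuiseuxAtInfinity (L : Type*) [Field L] :
    Subfield (HahnSeries ℚ L) where
  carrier := {z | ∃ N : ℕ, HasDenominator z N}
  mul_mem' := by
    rintro y z ⟨N, hN⟩ ⟨M, hM⟩
    exact ⟨N * M, (hN.mul_right hM.1).mul (Nat.mul_comm M N ▸ hM.mul_right hN.1)⟩
  add_mem' := by
    rintro y z ⟨N, hN⟩ ⟨M, hM⟩
    exact ⟨N * M, (hN.mul_right hM.1).add (Nat.mul_comm M N ▸ hM.mul_right hN.1)⟩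
  zero_mem' := ⟨1, by simpa using hasDenominator_single 0 (0 : L)⟩
  one_mem' := ⟨1, by simpa using hasDenominator_single 0 (1 : L)⟩
  neg_mem' := by
    rintro z ⟨N, hN⟩
    exact ⟨N, hN.1, fun q hq => hN.2 q (by simpa using hq)⟩
  inv_mem' := by
    rintro z ⟨N, hN⟩
    exact ⟨N, hN.inv⟩

namespace PuiseuxAtInfinity

/-- The constant series with value `c ∈ L`. -/
noncomputable def const (L : Type*) [Field L] : L →+* PuiseuxAtInfinity L :=
  HahnSeries.C.codRestrict (PuiseuxAtInfinity L)
    fun c => ⟨1, by simpa using hasDenominator_single 0 c⟩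

/-- The variable `x = t⁻¹` as a Puiseux series in `t = 1/x`. -/
noncomputable def x (L : Type*) [Field L] : PuiseuxAtInfinity L :=
  ⟨HahnSeries.single (-1) 1, 1, by simpa using hasDenominator_single (-1) (1 : L)⟩

/-- The highest exponent `h z` of `x` in a nonzero Puiseux series `z` in `1/x`
(the junk value at `z = 0` is `0`). -/
noncomputable def h {L : Type*} [Field L] (z : PuiseuxAtInfinity L) : ℚ :=
  -(z : HahnSeries ℚ L).order

/-- The highest term `c x ^ h` of a Puiseux series `c x ^ h + (smaller powers of x)`, `c ≠ 0`. -/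
noncomputable def highestTerm {L : Type*} [Field L] (z : PuiseuxAtInfinity L) : HahnSeries ℚ L :=
  HahnSeries.single (-h z) (z : HahnSeries ℚ L).leadingCoeff

/-- The value `χ(x, z)` of `χ ∈ K[x][y]` at `y = z`, for a Puiseux series `z` in `1/x` with
coefficients in an extension `L` of `K`. -/
noncomputable def evalAt {K L : Type*} [Field K] [Field L] [Algebra K L] (χ : K[X][Y])
    (z : PuiseuxAtInfinity L) : PuiseuxAtInfinity L :=
  eval₂ (eval₂RingHom ((const L).comp (algebraMap K L)) (x L)) z χ

end PuiseuxAtInfinity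

/-- The Newton polygon of `χ(x, y) = ∑ (χ.coeff j).coeff i * x ^ i * y ^ j` (an element of
`K[X][Y]`, the outer variable being `y`): the convex hull in the plane of the exponent vectors
`(i, j)` of its nonzero terms. -/
def newtonPolygon {K : Type*} [Field K] (χ : K[X][Y]) : Set (ℝ × ℝ) :=
  convexHull ℝ {p | ∃ i j : ℕ, (χ.coeff j).coeff i ≠ 0 ∧ p = ((i : ℝ), (j : ℝ))}

/-! ### The piecewise linear function `s ↦ ∑ k, max (h k) s` -/

/-! Write `h k` for the highest exponent of the root `y k`, and F(s) = ∑ k, max (h k) s. The theorem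
rests on F being the support function of the Newton polygon P in the directions (1, s): F(s) is the
maximum of i + s j over P. Indeed χ = ∏ (Y - y k), so the coefficient of Y^j is up to sign an
elementary symmetric polynomial in the roots. Its degree in x is at most the largest sum of n - j of
the `h k` (`exists_natDegree_coeff_le`), with equality if the n - j indices can be taken to be those
with `s < h k`, since one monomial then dominates (`natDegree_coeff_eq_sum_filter_lt`).

Likewise χ'(y l) is the product of y l - y k over k ≠ l. Distinct highest terms exclude
cancellation, so its highest exponent is F(h l) - h l. The inequality in 1 becomes a + 1 + h l (m +
1) < F(h l): the point lies strictly inside the supporting half plane with normal (1, h l). As F is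
linear between consecutive nodes `h l`, these half planes, together with 0 < i and 0 < j < n, cut
out the interior of P (`mem_interior_convexHull_of_forall_lt`). -/

theorem sum_max_eq_sum_filter_lt {ι : Type*} [Fintype ι] (h : ι → ℝ) (s : ℝ) :
    ∑ k, max (h k) s = ∑ k with s < h k, h k +
      ((Fintype.card ι : ℝ) - (Finset.univ.filter fun k => s < h k).card) * s := by
  classical
  rw [← Finset.sum_filter_add_sum_filter_not Finset.univ (fun k => s < h k)]
  congr 1
  · exact Finset.sum_congr rfl fun k hk => max_eq_left (Finset.mem_filter.1 hk).2.le
  · rw [Finset.sum_congr rfl fun k hk => max_eq_right (not_lt.1 (Finset.mem_filter.1 hk).2),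
      Finset.sum_const, nsmul_eq_mul, ← Finset.compl_filter, Finset.card_compl,
      Nat.cast_sub (Finset.card_le_univ _)]

/-- For `0 < j < card ι` the convex function `s ↦ ∑ k, max (h k) s - s * j` attains its minimum
at one of its nodes `h l`. -/
theorem exists_sum_max_sub_le {ι : Type*} [Fintype ι] (h : ι → ℝ) {j : ℝ} (hj : 0 < j)
    (hjn : j < Fintype.card ι) (s : ℝ) :
    ∃ l, ∑ k, max (h k) (h l) - h l * j ≤ ∑ k, max (h k) s - s * j := by
  classical
  set T := Finset.univ.filter fun k => s < h k with hT
  have hs := sum_max_eq_sum_filter_lt h s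
  rw [← hT] at hs
  have key : ∀ l, (∀ k ∈ T, h l ≤ h k) → (∀ k ∉ T, h k ≤ h l) →
      ∑ k, max (h k) (h l) = ∑ k ∈ T, h k + ((Fintype.card ι : ℝ) - T.card) * h l := by
    intro l h1 h2
    rw [← Finset.sum_add_sum_compl T]
    congr 1
    · exact Finset.sum_congr rfl fun k hk => max_eq_left (h1 k hk)
    · rw [Finset.sum_congr rfl fun k hk => max_eq_right (h2 k (Finset.mem_compl.1 hk)),
        Finset.sum_const, nsmul_eq_mul, Finset.card_compl, Nat.cast_sub (Finset.card_le_univ _)]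
  -- Just to the right of `s` the slope is n - |T| - j. If it is nonnegative, move left to the
  -- largest node ≤ `s`; otherwise move right to the smallest node > `s`. The bounds on `j` ensure
  -- that this node exists.
  rcases le_or_gt j ((Fintype.card ι : ℝ) - T.card) with hle | hlt
  · have hne : Tᶜ.Nonempty := by
      rw [← Finset.card_pos, Finset.card_compl]
      have : (T.card : ℝ) < Fintype.card ι := by linarith
      have : T.card < Fintype.card ι := by exact_mod_cast this
      omega
    obtain ⟨l, hl, hmax⟩ := Finset.exists_max_image Tᶜ h hne
    have hls : h l ≤ s := by simpa [hT] using hl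
    refine ⟨l, ?_⟩
    rw [key l (fun k hk => hls.trans (Finset.mem_filter.1 hk).2.le)
      (fun k hk => hmax k (Finset.mem_compl.2 hk)), hs]
    nlinarith
  · have hne : T.Nonempty := by
      rw [← Finset.card_pos]
      have : (0 : ℝ) < T.card := by linarith
      exact_mod_cast this
    obtain ⟨l, hl, hmin⟩ := Finset.exists_min_image T h hne
    have hls : s < h l := (Finset.mem_filter.1 hl).2
    refine ⟨l, ?_⟩
    rw [key l hmin (fun k hk => (by simpa [hT] using hk : h k ≤ s).trans hls.le), hs]
    nlinarith

/-- Bound `max (h k) s` below by `h k` on `T` and by `s` off `T`. With |T| = n - j this turns a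
degree bound into i + s j ≤ F(s). -/
theorem sum_le_sum_max_sub {ι : Type*} [Fintype ι] (h : ι → ℝ) (s : ℝ) (T : Finset ι) :
    ∑ k ∈ T, h k ≤ ∑ k, max (h k) s - s * ((Fintype.card ι : ℝ) - T.card) := by
  classical
  have h1 : ∑ k ∈ T, h k ≤ ∑ k ∈ T, max (h k) s := Finset.sum_le_sum fun k _ => le_max_left _ _
  have h2 : ∑ k ∈ Tᶜ, s ≤ ∑ k ∈ Tᶜ, max (h k) s := Finset.sum_le_sum fun k _ => le_max_right _ _
  rw [← Finset.sum_add_sum_compl T]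
  rw [Finset.sum_const, nsmul_eq_mul, Finset.card_compl,
    Nat.cast_sub (Finset.card_le_univ _)] at h2
  linarith

/-- Among the index sets of a given size, `{k | s < h k}` is the only one of maximal sum. -/
theorem sum_lt_sum_filter_lt {ι : Type*} [Fintype ι] (h : ι → ℝ) (s : ℝ) {T : Finset ι}
    (hcard : T.card = (Finset.univ.filter fun k => s < h k).card)
    (hne : T ≠ Finset.univ.filter fun k => s < h k) :
    ∑ k ∈ T, h k < ∑ k with s < h k, h k := by
  classical
  set U := Finset.univ.filter fun k => s < h k with hU
  obtain ⟨u, hu, huT⟩ : ∃ u ∈ U, u ∉ T := by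
    by_contra! hc
    exact hne (Finset.eq_of_subset_of_card_le hc hcard.le).symm
  have h1 : ∑ k ∈ T, (h k - s) ≤ ∑ k ∈ T, max (h k - s) 0 :=
    Finset.sum_le_sum fun k _ => le_max_left _ _
  have h2 : ∑ k ∈ T, max (h k - s) 0 < ∑ k, max (h k - s) 0 :=
    Finset.sum_lt_sum_of_subset (Finset.subset_univ _) (Finset.mem_univ u) huT
      (lt_max_of_lt_left (sub_pos.2 (Finset.mem_filter.1 hu).2)) fun _ _ _ => le_max_right _ _
  have h3 : ∑ k, max (h k - s) 0 = ∑ k ∈ U, (h k - s) := by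
    rw [hU, Finset.sum_filter]
    refine Finset.sum_congr rfl fun k _ => ?_
    split_ifs with hk
    · exact max_eq_left (sub_pos.2 hk).le
    · exact max_eq_right (sub_nonpos.2 (not_lt.1 hk))
  rw [h3] at h2
  have h4 := h1.trans_lt h2
  simp only [Finset.sum_sub_distrib, Finset.sum_const, hcard] at h4
  linarith

theorem sum_max_eq_of_antitone {n : ℕ} {h : Fin n → ℚ} (hh : Antitone h) (l : Fin n) :
    ∑ k, max (h k) (h l) = ∑ k ∈ Finset.Iio l, h k + ((n : ℚ) - (l : ℕ)) * h l := by
  rw [← Finset.sum_add_sum_compl (Finset.Iio l)]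
  congr 1
  · exact Finset.sum_congr rfl fun k hk => max_eq_left (hh (Finset.mem_Iio.1 hk).le)
  · rw [Finset.sum_congr rfl fun k hk => max_eq_right (hh (not_lt.1 fun hc =>
        Finset.mem_compl.1 hk (Finset.mem_Iio.2 hc))),
      Finset.sum_const, nsmul_eq_mul, Finset.card_compl, Fin.card_Iio, Fintype.card_fin,
      Nat.cast_sub l.2.le]

/-! ### Interior points of a convex hull in the plane -/

/-- An interior point can be pushed slightly in the direction (1, 0), which strictly increases the
functional. -/
theorem lt_of_mem_interior_of_forall_le {S : Set (ℝ × ℝ)} {s c : ℝ}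
    (hS : ∀ p ∈ S, p.1 + s * p.2 ≤ c) {p : ℝ × ℝ} (hp : p ∈ interior S) :
    p.1 + s * p.2 < c := by
  have hcont : Filter.Tendsto (fun ε : ℝ => ((p.1 + ε, p.2) : ℝ × ℝ)) (nhdsWithin 0 (Set.Ioi 0))
      (nhds p) := by
    refine tendsto_nhdsWithin_of_tendsto_nhds (Continuous.tendsto' (by fun_prop) _ _ (by simp))
  obtain ⟨ε, hmem, hε⟩ := ((hcont.eventually (mem_interior_iff_mem_nhds.1 hp)).and
    self_mem_nhdsWithin).exists
  have := hS _ hmem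
  replace hε : 0 < ε := hε
  dsimp only at this
  linarith

/-- The strict inequalities define an open set, so it suffices that each of its points lies in the
hull. A point outside would be strictly separated from `S` by a linear functional. -/
theorem mem_interior_convexHull_of_forall_lt {ι : Type*} [Finite ι] {S : Set (ℝ × ℝ)}
    (hfin : S.Finite) {d : ℝ} (h0 : (0, 0) ∈ S) (hd : (0, d) ∈ S) (h F : ι → ℝ)
    (hF : ∀ s j, 0 < j → j < d → ∃ l, ∃ p ∈ S, F l - h l * j ≤ p.1 + s * p.2 - s * j)
    {p : ℝ × ℝ} (hp1 : 0 < p.1) (hp2 : 0 < p.2) (hpd : p.2 < d)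
    (hp : ∀ l, p.1 + h l * p.2 < F l) : p ∈ interior (convexHull ℝ S) := by
  let Q : Set (ℝ × ℝ) := ({q | 0 < q.1} ∩ ({q | 0 < q.2} ∩ {q | q.2 < d})) ∩
    ⋂ l, {q | q.1 + h l * q.2 < F l}
  have hQ : IsOpen Q :=
    ((isOpen_lt continuous_const continuous_fst).inter
      ((isOpen_lt continuous_const continuous_snd).inter
        (isOpen_lt continuous_snd continuous_const))).inter
    (isOpen_iInter_of_finite fun l =>
      isOpen_lt (continuous_fst.add (continuous_const.mul continuous_snd)) continuous_const)
  refine interior_maximal (?_ : Q ⊆ _) hQ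
    ⟨⟨hp1, hp2, hpd⟩, Set.mem_iInter.2 hp⟩
  rintro q ⟨⟨hq1, hq2, hqd⟩, hq⟩
  replace hq1 : 0 < q.1 := hq1
  replace hq2 : 0 < q.2 := hq2
  replace hqd : q.2 < d := hqd
  by_contra hnot
  obtain ⟨f, u, hfu, huq⟩ := geometric_hahn_banach_closed_point (convex_convexHull ℝ S)
    (hfin.isClosed_convexHull ℝ) hnot
  have hf : ∀ r : ℝ × ℝ, f r = f (1, 0) * r.1 + f (0, 1) * r.2 := by
    intro r
    have : r = r.1 • ((1 : ℝ), (0 : ℝ)) + r.2 • ((0 : ℝ), (1 : ℝ)) := by ext <;> simp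
    conv_lhs => rw [this]
    rw [map_add, map_smul, map_smul, smul_eq_mul, smul_eq_mul]
    ring
  have hlt : ∀ r ∈ S, f (1, 0) * r.1 + f (0, 1) * r.2 < f (1, 0) * q.1 + f (0, 1) * q.2 := by
    intro r hr
    rw [← hf, ← hf]
    exact (hfu r (subset_convexHull ℝ S hr)).trans huq
  generalize f (1, 0) = α at hlt
  generalize f (0, 1) = β at hlt
  rcases le_or_gt α 0 with hα | hα
  -- Here (0, 0) forces β > 0, and then (0, d) gives β d < β q.2, against q.2 < d.
  · have e1 := hlt _ h0
    have e2 := hlt _ hd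
    simp only at e1 e2
    have hβ : 0 < β := by
      by_contra hc
      nlinarith
    nlinarith
  -- Rescaled, the functional has normal (1, β / α), and `hF` compares this direction with a node.
  · obtain ⟨l, r, hr, hle⟩ := hF (β / α) q.2 hq2 hqd
    have e1 := hlt r hr
    have e2 : q.1 + h l * q.2 < F l := Set.mem_iInter.1 hq l
    have hβ : β = α * (β / α) := by field_simp
    rw [hβ] at e1
    have e3 : α * (r.1 + β / α * r.2 - (q.1 + β / α * q.2)) < 0 := by linarith
    have e4 := neg_of_mul_neg_right e3 hα.le
    linarith

/-! ### Highest exponents as a valuation -/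

namespace PuiseuxAtInfinity

/-- The valuation `z ↦ -h z` on the Puiseux series in `1/x`, with value `⊤` at `0`. -/
noncomputable def val (L : Type*) [Field L] : AddValuation (PuiseuxAtInfinity L) (WithTop ℚ) :=
  (HahnSeries.addVal ℚ L).comap (PuiseuxAtInfinity L).subtype

/-- The embedding of `K[x]` into the Puiseux series in `1/x`. -/
noncomputable def ofPolynomial (K L : Type*) [Field K] [Field L] [Algebra K L] :
    K[X] →+* PuiseuxAtInfinity L :=
  eval₂RingHom ((const L).comp (algebraMap K L)) (x L)

variable {K L : Type*} [Field K] [Field L] [Algebra K L]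

theorem val_eq_orderTop (z : PuiseuxAtInfinity L) :
    val L z = (z : HahnSeries ℚ L).orderTop := rfl

theorem val_of_ne_zero {z : PuiseuxAtInfinity L} (hz : z ≠ 0) :
    val L z = ((-h z : ℚ) : WithTop ℚ) := by
  rw [val_eq_orderTop, h, neg_neg, HahnSeries.order_eq_orderTop_of_ne_zero]
  simpa using hz

theorem h_eq_of_val_eq {z : PuiseuxAtInfinity L} {q : ℚ} (hz : val L z = ((-q : ℚ) : WithTop ℚ)) :
    z ≠ 0 ∧ h z = q := by
  have hne : z ≠ 0 := by
    rintro rfl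
    rw [AddValuation.map_zero] at hz
    exact WithTop.coe_ne_top hz.symm
  refine ⟨hne, ?_⟩
  rw [val_of_ne_zero hne, WithTop.coe_inj] at hz
  exact neg_injective hz

theorem h_mul {y z : PuiseuxAtInfinity L} (hy : y ≠ 0) (hz : z ≠ 0) : h (y * z) = h y + h z := by
  refine (h_eq_of_val_eq ?_).2
  rw [AddValuation.map_mul, val_of_ne_zero hy, val_of_ne_zero hz, ← WithTop.coe_add, neg_add]

theorem h_one : h (1 : PuiseuxAtInfinity L) = 0 := by
  simp [h]

theorem h_pow {z : PuiseuxAtInfinity L} (hz : z ≠ 0) (k : ℕ) : h (z ^ k) = k * h z := by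
  induction k with
  | zero => simp [h_one]
  | succ k ih => rw [pow_succ, h_mul (pow_ne_zero k hz) hz, ih]; push_cast; ring

theorem h_div {y z : PuiseuxAtInfinity L} (hy : y ≠ 0) (hz : z ≠ 0) : h (y / z) = h y - h z := by
  have := h_mul (div_ne_zero hy hz) hz
  rw [div_mul_cancel₀ y hz] at this
  linarith

theorem h_prod {ι : Type*} (s : Finset ι) {f : ι → PuiseuxAtInfinity L} (hf : ∀ i ∈ s, f i ≠ 0) :
    h (∏ i ∈ s, f i) = ∑ i ∈ s, h (f i) := by
  classical
  induction s using Finset.induction_on with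
  | empty => simp [h_one]
  | insert i s hi ih =>
    rw [Finset.prod_insert hi, Finset.sum_insert hi, h_mul (hf i (Finset.mem_insert_self i s))
      (Finset.prod_ne_zero_iff.2 fun j hj => hf j (Finset.mem_insert_of_mem hj)),
      ih fun j hj => hf j (Finset.mem_insert_of_mem hj)]

theorem x_ne_zero_and_h_x : x L ≠ 0 ∧ h (x L) = 1 :=
  h_eq_of_val_eq (HahnSeries.orderTop_single one_ne_zero)

/-- The difference of two series with distinct highest terms has no cancellation. -/
theorem sub_ne_zero_and_h_sub {y z : PuiseuxAtInfinity L} (hy : y ≠ 0) (hz : z ≠ 0)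
    (hyz : highestTerm y ≠ highestTerm z) : y - z ≠ 0 ∧ h (y - z) = max (h y) (h z) := by
  apply h_eq_of_val_eq
  have hvy := val_of_ne_zero hy
  have hvz := val_of_ne_zero hz
  rcases lt_trichotomy (h y) (h z) with hlt | heq | hgt
  · rw [max_eq_right hlt.le, ← hvz]
    refine AddValuation.map_sub_eq_of_lt_right _ ?_
    rw [hvy, hvz, WithTop.coe_lt_coe]
    exact neg_lt_neg hlt
  · rw [heq, max_self]
    have hoy : (y : HahnSeries ℚ L).order = -h z := by rw [← heq, h, neg_neg]
    have hoz : (z : HahnSeries ℚ L).order = -h z := by rw [h, neg_neg]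
    refine HahnSeries.orderTop_eq_of_le ?_ fun q hq => ?_
    · change ((y : HahnSeries ℚ L) - z).coeff (-h z) ≠ 0
      rw [HahnSeries.coeff_sub, sub_ne_zero]
      intro hc
      apply hyz
      rw [highestTerm, highestTerm, HahnSeries.leadingCoeff_eq, HahnSeries.leadingCoeff_eq,
        hoy, hoz, heq, hc]
    · by_contra hc
      apply hq
      change ((y : HahnSeries ℚ L) - z).coeff q = 0
      rw [HahnSeries.coeff_sub, HahnSeries.coeff_eq_zero_of_lt_order (hoy ▸ not_le.1 hc),
        HahnSeries.coeff_eq_zero_of_lt_order (hoz ▸ not_le.1 hc), sub_zero]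
  · rw [max_eq_left hgt.le, ← hvy]
    refine AddValuation.map_sub_eq_of_lt_left _ ?_
    rw [hvy, hvz, WithTop.coe_lt_coe]
    exact neg_lt_neg hgt

theorem coe_ofPolynomial (p : K[X]) : (ofPolynomial K L p : HahnSeries ℚ L) =
    ∑ i ∈ p.support, HahnSeries.single (-(i : ℚ)) (algebraMap K L (p.coeff i)) := by
  have hx : ∀ i : ℕ, ((x L ^ i : PuiseuxAtInfinity L) : HahnSeries ℚ L) =
      HahnSeries.single (-(i : ℚ)) 1 := by
    intro i
    change (HahnSeries.single (-1 : ℚ) (1 : L)) ^ i = _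
    rw [HahnSeries.single_pow]
    simp
  rw [ofPolynomial, coe_eval₂RingHom, eval₂_eq_sum, Polynomial.sum, AddSubmonoidClass.coe_finsetSum]
  refine Finset.sum_congr rfl fun i _ => ?_
  rw [MulMemClass.coe_mul, hx]
  change HahnSeries.single 0 _ * _ = _
  rw [HahnSeries.single_mul_single]
  simp

theorem val_ofPolynomial {p : K[X]} (hp : p ≠ 0) :
    val L (ofPolynomial K L p) = ((-p.natDegree : ℚ) : WithTop ℚ) := by
  rw [val_eq_orderTop, coe_ofPolynomial]
  refine HahnSeries.orderTop_eq_of_le ?_ fun q hq => ?_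
  · rw [HahnSeries.mem_support, HahnSeries.coeff_sum, Finset.sum_eq_single p.natDegree,
      HahnSeries.coeff_single_same]
    · simpa using hp
    · intro i _ hi
      exact HahnSeries.coeff_single_of_ne fun hc => hi (by exact_mod_cast (neg_injective hc).symm)
    · intro hc
      exact absurd (natDegree_mem_support_of_nonzero hp) hc
  · rw [HahnSeries.mem_support, HahnSeries.coeff_sum] at hq
    obtain ⟨i, hi, hne⟩ := Finset.exists_ne_zero_of_sum_ne_zero hq
    have hqi : q = -(i : ℚ) := by
      by_contra hc
      exact hne (HahnSeries.coeff_single_of_ne hc)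
    rw [hqi, neg_le_neg_iff]
    exact_mod_cast le_natDegree_of_mem_supp i hi

theorem evalAt_eq_eval (χ : K[X][Y]) (z : PuiseuxAtInfinity L) :
    evalAt χ z = (χ.map (ofPolynomial K L)).eval z :=
  eval₂_eq_eval_map _

/-! ### Coefficients of a product of linear factors -/

theorem coeff_prod_X_sub_C {R ι : Type*} [CommRing R] [Fintype ι] (y : ι → R) {j : ℕ}
    (hj : j ≤ Fintype.card ι) :
    (∏ l, (X - C (y l))).coeff j = (-1) ^ (Fintype.card ι - j) *
      ∑ T ∈ Finset.univ.powersetCard (Fintype.card ι - j), ∏ l ∈ T, y l := by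
  have := Multiset.prod_X_sub_C_coeff (Finset.univ.val.map y) (k := j) (by simpa using hj)
  rw [Finset.esymm_map_val] at this
  simp only [Multiset.map_map, Function.comp_def, Multiset.card_map, Finset.card_val,
    Finset.card_univ] at this
  exact this

theorem val_neg_one_pow_mul (k : ℕ) (z : PuiseuxAtInfinity L) :
    val L ((-1) ^ k * z) = val L z := by
  rcases neg_one_pow_eq_or (PuiseuxAtInfinity L) k with hk | hk <;> simp [hk]

section Coefficients

variable {ι : Type*} [Fintype ι] {χ : K[X][Y]} {y : ι → PuiseuxAtInfinity L}

theorem exists_natDegree_coeff_le (hy : ∀ l, y l ≠ 0)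
    (hχ : χ.map (ofPolynomial K L) = ∏ l, (X - C (y l))) {j : ℕ} (hj : χ.coeff j ≠ 0) :
    j ≤ Fintype.card ι ∧ ∃ T : Finset ι, T.card = Fintype.card ι - j ∧
      ((χ.coeff j).natDegree : ℚ) ≤ ∑ l ∈ T, h (y l) := by
  have hv := val_ofPolynomial (L := L) hj
  rw [← coeff_map, hχ] at hv
  have hjn : j ≤ Fintype.card ι := by
    by_contra hc
    rw [coeff_eq_zero_of_natDegree_lt, AddValuation.map_zero] at hv
    · exact WithTop.coe_ne_top hv.symm
    · rw [natDegree_finsetProd_X_sub_C_eq_card, Finset.card_univ]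
      exact not_le.1 hc
  refine ⟨hjn, ?_⟩
  rw [coeff_prod_X_sub_C y hjn, val_neg_one_pow_mul] at hv
  by_contra! hc
  refine (AddValuation.map_lt_sum (val L) (g := ((-(χ.coeff j).natDegree : ℚ) : WithTop ℚ))
    WithTop.coe_ne_top fun T hT => ?_).ne' hv
  rw [val_of_ne_zero (Finset.prod_ne_zero_iff.2 fun l _ => hy l), h_prod T fun l _ => hy l,
    WithTop.coe_lt_coe, neg_lt_neg_iff]
  exact hc T (Finset.mem_powersetCard.1 hT).2

/-- Among the monomials of this elementary symmetric polynomial, the product over `{l | s < h (y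
l)}` has strictly the largest exponent, so nothing cancels it. -/
theorem natDegree_coeff_eq_sum_filter_lt (hy : ∀ l, y l ≠ 0)
    (hχ : χ.map (ofPolynomial K L) = ∏ l, (X - C (y l))) (s : ℝ) :
    χ.coeff (Fintype.card ι - (Finset.univ.filter fun l => s < (h (y l) : ℝ)).card) ≠ 0 ∧
    ((χ.coeff (Fintype.card ι -
      (Finset.univ.filter fun l => s < (h (y l) : ℝ)).card)).natDegree : ℚ) =
        ∑ l with s < (h (y l) : ℝ), h (y l) := by
  classical
  set U := Finset.univ.filter fun l => s < (h (y l) : ℝ) with hU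
  have hUn : U.card ≤ Fintype.card ι := Finset.card_le_univ U
  have hprod : ∀ T : Finset ι, val L (∏ l ∈ T, y l) = ((-∑ l ∈ T, h (y l) : ℚ) : WithTop ℚ) := by
    intro T
    rw [val_of_ne_zero (Finset.prod_ne_zero_iff.2 fun l _ => hy l), h_prod T fun l _ => hy l]
  have hval : val L (ofPolynomial K L (χ.coeff (Fintype.card ι - U.card))) =
      ((-∑ l ∈ U, h (y l) : ℚ) : WithTop ℚ) := by
    rw [← coeff_map, hχ, coeff_prod_X_sub_C y (Nat.sub_le _ _), val_neg_one_pow_mul,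
      Nat.sub_sub_self hUn, ← Finset.add_sum_erase _ _
        (Finset.mem_powersetCard.2 ⟨Finset.subset_univ U, rfl⟩),
      AddValuation.map_add_eq_of_lt_left, hprod]
    rw [hprod]
    refine AddValuation.map_lt_sum _ WithTop.coe_ne_top fun T hT => ?_
    rw [Finset.mem_erase, Finset.mem_powersetCard] at hT
    rw [hprod, WithTop.coe_lt_coe, neg_lt_neg_iff]
    have := sum_lt_sum_filter_lt (fun l => (h (y l) : ℝ)) s hT.2.2 hT.1
    exact_mod_cast this
  have hne : χ.coeff (Fintype.card ι - U.card) ≠ 0 := by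
    intro hc
    rw [hc, map_zero, AddValuation.map_zero] at hval
    exact WithTop.coe_ne_top hval.symm
  refine ⟨hne, ?_⟩
  rw [val_ofPolynomial hne, WithTop.coe_inj] at hval
  exact neg_injective hval

end Coefficients

/-! ### Roots with distinct highest terms -/

section Roots

variable {n : ℕ} {χ : K[X][Y]} {y : Fin n → PuiseuxAtInfinity L}

theorem map_eq_prod_of_roots (hmonic : χ.Monic) (hdeg : χ.natDegree = n)
    (hroot : ∀ l, evalAt χ (y l) = 0) (hy : Function.Injective y) :
    χ.map (ofPolynomial K L) = ∏ l, (X - C (y l)) := by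
  refine eq_of_monic_of_dvd_of_natDegree_le (monic_prod_of_monic _ _ fun l _ => monic_X_sub_C _)
    (hmonic.map _) ?_ ?_
  · refine Finset.prod_dvd_of_coprime (fun i _ j _ hij => pairwise_coprime_X_sub_C hy hij)
      fun l _ => ?_
    rw [dvd_iff_isRoot, IsRoot, ← evalAt_eq_eval, hroot]
  · rw [natDegree_finsetProd_X_sub_C_eq_card, Finset.card_univ, Fintype.card_fin,
      hmonic.natDegree_map, hdeg]

theorem root_ne_zero (hconst : (χ.coeff 0).coeff 0 ≠ 0) {z : PuiseuxAtInfinity L}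
    (hz : evalAt χ z = 0) : z ≠ 0 := by
  rintro rfl
  rw [evalAt_eq_eval, ← coeff_zero_eq_eval_zero, coeff_map] at hz
  have hv := val_ofPolynomial (L := L) (p := χ.coeff 0) fun hc => hconst (by rw [hc, coeff_zero])
  rw [hz, AddValuation.map_zero] at hv
  exact WithTop.coe_ne_top hv.symm

theorem h_evalAt_derivative (hχ : χ.map (ofPolynomial K L) = ∏ l, (X - C (y l)))
    (hy : ∀ l, y l ≠ 0) (hdistinct : Function.Injective fun l => highestTerm (y l)) (l : Fin n) :
    evalAt (derivative χ) (y l) ≠ 0 ∧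
      h (evalAt (derivative χ) (y l)) = ∑ k, max (h (y k)) (h (y l)) - h (y l) := by
  classical
  have hsub : ∀ k ∈ Finset.univ.erase l, y l - y k ≠ 0 ∧ h (y l - y k) = max (h (y l)) (h (y k)) :=
    fun k hk => sub_ne_zero_and_h_sub (hy l) (hy k) fun hc =>
      (Finset.mem_erase.1 hk).1 (hdistinct hc).symm
  have heval : evalAt (derivative χ) (y l) = ∏ k ∈ Finset.univ.erase l, (y l - y k) := by
    rw [evalAt_eq_eval, ← derivative_map, hχ, derivative_prod_finset, eval_finsetSum,
      Finset.sum_eq_single l]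
    · simp [eval_prod]
    · intro k _ hkl
      rw [derivative_X_sub_C, mul_one, eval_prod]
      exact Finset.prod_eq_zero (Finset.mem_erase.2 ⟨hkl.symm, Finset.mem_univ l⟩) (by simp)
    · intro hc
      exact absurd (Finset.mem_univ l) hc
  rw [heval]
  refine ⟨Finset.prod_ne_zero_iff.2 fun k hk => (hsub k hk).1, ?_⟩
  rw [h_prod _ fun k hk => (hsub k hk).1, Finset.sum_congr rfl fun k hk => (hsub k hk).2,
    ← Finset.add_sum_erase Finset.univ _ (Finset.mem_univ l), max_self, add_sub_cancel_left]
  exact Finset.sum_congr rfl fun k _ => max_comm _ _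

/-- The condition on the highest exponents, in terms of the highest exponents of the roots. -/
theorem h_quotient_lt_iff (hχ : χ.map (ofPolynomial K L) = ∏ l, (X - C (y l)))
    (hy : ∀ l, y l ≠ 0) (hdistinct : Function.Injective fun l => highestTerm (y l)) (a m : ℕ)
    (l : Fin n) :
    h (x L ^ a * y l ^ m / evalAt (derivative χ) (y l)) < -1 ↔
      (a : ℚ) + 1 + h (y l) * (m + 1) < ∑ k, max (h (y k)) (h (y l)) := by
  obtain ⟨hne, hd⟩ := h_evalAt_derivative hχ hy hdistinct l
  rw [h_div (mul_ne_zero (pow_ne_zero a x_ne_zero_and_h_x.1) (pow_ne_zero m (hy l))) hne,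
    h_mul (pow_ne_zero a x_ne_zero_and_h_x.1) (pow_ne_zero m (hy l)), h_pow x_ne_zero_and_h_x.1,
    h_pow (hy l), x_ne_zero_and_h_x.2, hd]
  constructor <;> intro <;> linarith

theorem finite_exponents (χ : K[X][Y]) :
    {p : ℝ × ℝ | ∃ i j : ℕ, (χ.coeff j).coeff i ≠ 0 ∧ p = ((i : ℝ), (j : ℝ))}.Finite := by
  refine ((χ.support.biUnion fun j => (χ.coeff j).support.image
    fun i : ℕ => ((i : ℝ), (j : ℝ))).finite_toSet).subset ?_
  rintro p ⟨i, j, hij, rfl⟩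
  rw [Finset.mem_coe, Finset.mem_biUnion]
  refine ⟨j, mem_support_iff.2 fun hc => hij (by rw [hc, coeff_zero]), ?_⟩
  exact Finset.mem_image_of_mem _ (mem_support_iff.2 hij)

/-- The Newton polygon lies in the half planes given by the support function of the roots. -/
theorem newtonPolygon_le (hχ : χ.map (ofPolynomial K L) = ∏ l, (X - C (y l)))
    (hy : ∀ l, y l ≠ 0) (s : ℝ) :
    ∀ p ∈ newtonPolygon χ, p.1 + s * p.2 ≤ ∑ k, max (h (y k) : ℝ) s := by
  have hconv : Convex ℝ {p : ℝ × ℝ | p.1 + s * p.2 ≤ ∑ k, max (h (y k) : ℝ) s} :=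
    convex_halfSpace_le (f := fun p : ℝ × ℝ => p.1 + s * p.2)
      ⟨fun p q => by simp only [Prod.fst_add, Prod.snd_add]; ring,
        fun c p => by simp only [Prod.smul_fst, Prod.smul_snd, smul_eq_mul]; ring⟩ _
  refine fun p hp => convexHull_min ?_ hconv hp
  rintro _ ⟨i, j, hij, rfl⟩
  obtain ⟨hjn, T, hT, hle⟩ := exists_natDegree_coeff_le hy hχ
    (j := j) fun hc => hij (by rw [hc, coeff_zero])
  have h1 : (i : ℝ) ≤ ∑ l ∈ T, (h (y l) : ℝ) := by
    have : (i : ℚ) ≤ ∑ l ∈ T, h (y l) :=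
      (Nat.cast_le.2 (le_natDegree_of_ne_zero hij)).trans hle
    exact_mod_cast this
  have h2 := sum_le_sum_max_sub (fun l => (h (y l) : ℝ)) s T
  rw [hT, Nat.cast_sub hjn, sub_sub_cancel] at h2
  change (i : ℝ) + s * j ≤ _
  linarith

theorem mem_interior_newtonPolygon_iff (hn : 0 < n) (hmonic : χ.Monic) (hdeg : χ.natDegree = n)
    (hconst : (χ.coeff 0).coeff 0 ≠ 0)
    (hχ : χ.map (ofPolynomial K L) = ∏ l, (X - C (y l))) (hy : ∀ l, y l ≠ 0) (a m : ℕ) :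
    ((a : ℝ) + 1, (m : ℝ) + 1) ∈ interior (newtonPolygon χ) ↔
      ∀ l, (a : ℚ) + 1 + h (y l) * (m + 1) < ∑ k, max (h (y k)) (h (y l)) := by
  constructor
  · intro hmem l
    have := lt_of_mem_interior_of_forall_le (newtonPolygon_le hχ hy (h (y l))) hmem
    dsimp only at this
    exact_mod_cast this
  · intro hlt
    have hc0 : χ.coeff 0 ≠ 0 := fun hc => hconst (by rw [hc, coeff_zero])
    -- At the largest exponent the hypothesis reads a + 1 + h (m + 1) < n h. The constant
    -- coefficient has degree ≥ 0, so ∑ h k ≥ 0 and h ≥ 0; hence m + 1 < n.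
    have hmn : m + 1 < n := by
      have : Nonempty (Fin n) := ⟨⟨0, hn⟩⟩
      obtain ⟨l, -, hl⟩ := Finset.exists_max_image Finset.univ (fun k => h (y k))
        Finset.univ_nonempty
      obtain ⟨-, T, hT, hle⟩ := exists_natDegree_coeff_le hy hχ hc0
      rw [(Finset.card_eq_iff_eq_univ T).1 hT] at hle
      have h1 : ∑ k, h (y k) ≤ ∑ _k : Fin n, h (y l) := Finset.sum_le_sum hl
      have h2 := hlt l
      rw [Finset.sum_congr rfl fun k hk => max_eq_right (hl k hk)] at h2
      rw [Finset.sum_const, Finset.card_univ, Fintype.card_fin, nsmul_eq_mul] at h1 h2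
      have h3 : (0 : ℚ) ≤ (χ.coeff 0).natDegree := Nat.cast_nonneg _
      have h4 : (0 : ℚ) < n := Nat.cast_pos.2 hn
      have h5 : 0 ≤ h (y l) := by
        by_contra hc
        nlinarith
      by_contra hc
      have h6 : (n : ℚ) ≤ m + 1 := by exact_mod_cast not_lt.1 hc
      have h7 : (0 : ℚ) ≤ a := Nat.cast_nonneg _
      nlinarith
    refine mem_interior_convexHull_of_forall_lt (finite_exponents χ) (d := n)
      ⟨0, 0, hconst, by simp⟩ ⟨0, n, ?_, by simp⟩ (fun l => (h (y l) : ℝ))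
      (fun l => ∑ k, max (h (y k) : ℝ) (h (y l))) ?_ (by positivity) (by positivity)
      (by dsimp only; exact_mod_cast hmn) fun l => by dsimp only; exact_mod_cast hlt l
    · rw [← hdeg, hmonic.coeff_natDegree]
      simp
    · intro s j hj hjn
      obtain ⟨l, hl⟩ := exists_sum_max_sub_le (fun k => (h (y k) : ℝ)) hj
        (by rwa [Fintype.card_fin]) s
      obtain ⟨hne, hd⟩ := natDegree_coeff_eq_sum_filter_lt hy hχ s
      -- The witness is the leading exponent of the coefficient of Y^(n - #{k | s < h k}), where i +
      -- s j attains F(s).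
      refine ⟨l, _, ⟨_, _, leadingCoeff_ne_zero.2 hne, rfl⟩, hl.trans (le_of_eq ?_)⟩
      rw [sum_max_eq_sum_filter_lt, Nat.cast_sub (Finset.card_le_univ _), mul_comm s]
      have hd' := congrArg (Rat.cast : ℚ → ℝ) hd
      push_cast at hd'
      rw [hd']
      ring

end Roots

end PuiseuxAtInfinity

theorem lemma5p2 {K L : Type*} [Field K] [CharZero K] [Field L] [Algebra K L] [IsAlgClosed L]
    (χ : K[X][Y]) (n : ℕ) (hn : 0 < n)
    -- `χ` is monic of degree `n` in `y`, with nonzero constant term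
    (hmonic : χ.Monic) (hdeg : χ.natDegree = n)
    (hconst : (χ.coeff 0).coeff 0 ≠ 0)
    -- the roots of `χ` as Puiseux series in `1/x`: `n` solutions with distinct highest terms
    -- (in particular `n` distinct solutions, hence all of them)
    (y : Fin n → PuiseuxAtInfinity L)
    (hroot : ∀ l, PuiseuxAtInfinity.evalAt χ (y l) = 0)
    (hdistinct : Function.Injective fun l => PuiseuxAtInfinity.highestTerm (y l))
    (a m : ℕ) :
    -- Abel's inequalities hold iff `(a + 1, m + 1)` is in the interior of the Newton polygon
    ((∀ l, PuiseuxAtInfinity.h (PuiseuxAtInfinity.x L ^ a * y l ^ m /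
          PuiseuxAtInfinity.evalAt (derivative χ) (y l)) < -1) ↔
        ((a : ℝ) + 1, (m : ℝ) + 1) ∈ interior (newtonPolygon χ)) ∧
    -- and, if `h₁ ≥ ⋯ ≥ hₙ`, both are equivalent to the explicit form of the inequalities;
    -- the index `l : Fin n` stands for `ℓ = l + 1`
    ((Antitone fun l => PuiseuxAtInfinity.h (y l)) →
      ((∀ l : Fin n, (a : ℚ) < (∑ k ∈ Finset.Iio l, PuiseuxAtInfinity.h (y k)) +
          ((n : ℚ) - ((l : ℕ) + 1) - m) * PuiseuxAtInfinity.h (y l) - 1) ↔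
        ((a : ℝ) + 1, (m : ℝ) + 1) ∈ interior (newtonPolygon χ))) := by
  have hy : ∀ l, y l ≠ 0 := fun l => PuiseuxAtInfinity.root_ne_zero hconst (hroot l)
  have hχ := PuiseuxAtInfinity.map_eq_prod_of_roots hmonic hdeg hroot
    (Function.Injective.of_comp (f := PuiseuxAtInfinity.highestTerm) hdistinct)
  have hmem := PuiseuxAtInfinity.mem_interior_newtonPolygon_iff hn hmonic hdeg hconst hχ hy a m
  refine ⟨?_, fun hanti => ?_⟩
  · rw [hmem]
    exact forall_congr' fun l =>
      PuiseuxAtInfinity.h_quotient_lt_iff hχ hy hdistinct a m l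
  · rw [hmem]
    refine forall_congr' fun l => ?_
    rw [sum_max_eq_of_antitone hanti l]
    -- The term k = l of F(h l) accounts for n - l here against n - (l + 1) in the statement.
    constructor <;> intro <;> linarith
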